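/- **Theorem 4.1 (Spectral decomposition of $S^n_{(1)}$).** Let $n\ge 1$, $N=2^n$, $[m]=\{0,\dots,m-1\}$, and $E^n_1=\{(h,s)\in\mathbb Z\times[N] : -(s \bmod 2)\le h<N\}$. For an image $f\in\mathbb R^{N\times N}$, extended by zero to $\mathbb Z\times [N]$, let $S^n_1f\in\mathbb R^{E^n_1}$ be given by $$(S^n_1f)(h,2\ell)=f(h,2\ell)+f(h,2\ell+1),\qquad (S^n_1f)(h,2\ell+1)=f(h,2\ell)+f(h+1,2\ell+1),$$ and let $S^n_{(1)}f=(S^n_1T_{\rm I}f,\,S^n_1T_{\rm II}f,\,S^n_1T_{\rm III}f,\,S^n_1T_{\rm IV}f)\in\mathbb R^{4\times E^n_1}$, where $$(T_{\rm I}f)(i,j)=f(j,N-1-i),\quad (T_{\rm II}f)(i,j)=f(N-1-i,j),\quad (T_{\rm III}f)(i,j)=f(i,j),\quad (T_{\rm IV}f)(i,j)=f(N-1-j,N-1-i).$$ For $p\in[4]$ and $(j_1,j_2)\in[N/2]^2$ let $\chi^{(p)}_{(j_1,j_2)}\in\mathbb R^{N\times N}$ be the image that equals, on the rows $2j_1,2j_1+1$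 and columns $2j_2,2j_2+1$, the pattern $$p=0:\begin{bmatrix}1&0\\0&1\end{bmatrix},\quad p=1:\begin{bmatrix}-1&0\\0&1\end{bmatrix},\quad p=2:\begin{bmatrix}0&1\\1&0\end{bmatrix},\quad p=3:\begin{bmatrix}0&-1\\1&0\end{bmatrix},$$ and vanishes elsewhere. For $k_1,k_2\in\{1,\dots,N/2\}$ put $\theta_k=\frac{k\pi}{N/2+1}$, $\sigma^+_k=2\cos\frac{k\pi}{N+2}$, $\sigma^-_k=2\sin\frac{k\pi}{N+2}$, and $$\phi(j_1,j_2)=\tfrac4{N+2}\sin(\theta_{k_1}(j_1+1))\sin(\theta_{k_2}(j_2+1)),$$ $$\psi^{+\circ}(j_1,j_2)=\tfrac4{N+2}\sin(\theta_{k_1}(j_1+\tfrac12))\sin(\theta_{k_2}(j_2+1)),\qquad \psi^{\circ+}(j_1,j_2)=\tfrac4{N+2}\sin(\theta_{k_1}(j_1+1))\sin(\theta_{k_2}(j_2+\tfrac12)),$$ $$\psi^{-\circ}(j_1,j_2)=\tfrac4{N+2}\cos(\theta_{k_1}(j_1+\tfrac12))\sin(\theta_{k_2}(j_2+1)),\qquad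 \psi^{\circ-}(j_1,j_2)=\tfrac4{N+2}\sin(\theta_{k_1}(j_1+1))\cos(\theta_{k_2}(j_2+\tfrac12))$$ (the indices $k_1,k_2$ are suppressed; $j_1,j_2\in[N/2]$, except that a variable with the shift $\frac12$ runs through $[N/2+1]$), and $$v^{(p)}_{(k_1,k_2)}=\frac1{\sqrt2}\sum_{(j_1,j_2)\in[N/2]^2}\phi(j_1,j_2)\,\chi^{(p)}_{(j_1,j_2)}.$$ Sort $g\in\mathbb R^{E^n_1}$ into four blocks by the permutation $O^n_1 g=(w_1,w_2,w_3,w_4)$, where, for $b\in[N/2]$, $$w_1(a,b)=g(2a+1,2b),\quad w_2(a,b)=g(2a,2b),\quad w_3(a,b)=g(2a,2b+1)\quad(a\in[N/2]),\qquad w_4(a,b)=g(2a-1,2b+1)\quad(a\in[N/2+1]).$$ Let $u^{(p)}_{(k_1,k_2)}=\operatorname{blockdiag}(O^{n\top}_1,O^{n\top}_1,O^{n\top}_1,O^{n\top}_1)\,w^{(p)}_{(k_1,k_2)}$, where $\sqrt2\,w^{(p)}_{(k_1,k_2)}$ consists of the following blocks $(w_1,w_2,w_3,w_4)$ for the four quadrants: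 $$\begin{array}{c|c|c|c|c} p&{\rm I}&{\rm II}&{\rm III}&{\rm IV}\\\hline 0&(\phi,\phi,0,\sigma^+_{k_2}\psi^{\circ+})&(\phi,\phi,0,\sigma^+_{k_1}\psi^{+\circ})&(\phi,\phi,2\phi,0)&(\phi,\phi,2\phi,0)\\ 1&(-\phi,\phi,0,-\sigma^-_{k_2}\psi^{\circ-})&(-\phi,\phi,0,-\sigma^-_{k_1}\psi^{-\circ})&(\phi,-\phi,0,0)&(-\phi,\phi,0,0)\\ 2&(\phi,\phi,2\phi,0)&(\phi,\phi,2\phi,0)&(\phi,\phi,0,\sigma^+_{k_1}\psi^{+\circ})&(\phi,\phi,0,\sigma^+_{k_2}\psi^{\circ+})\\ 3&(\phi,-\phi,0,0)&(-\phi,\phi,0,0)&(\phi,-\phi,0,-\sigma^-_{k_1}\psi^{-\circ})&(\phi,-\phi,0,\sigma^-_{k_2}\psi^{\circ-}) \end{array}$$ Here the functions are composed with the orientation of the quadrant: at block position $(a,b)$, with $M=N/2$, $\phi$ is evaluated at $(b,M-1-a)$, $(M-1-a,b)$, $(a,b)$, $(M-1-b,M-1-a)$ in quadrants I, II, III, IV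 respectively, and the $\psi$'s (in $w_4$) at $(b,M-a)$, $(M-a,b)$, $(a,b)$, $(M-1-b,M-a)$. Then $$S^n_{(1)}=U^n_{(1)}\,\Sigma^n_{(1)}\,V^{n\top}_{(1)},$$ where the columns are indexed by $(p,k_1,k_2)\in[4]\times\{1,\dots,N/2\}^2$; the columns of $V^n_{(1)}$ are $v^{(p)}_{(k_1,k_2)}$ and are orthonormal; $\Sigma^n_{(1)}$ is diagonal with the diagonal values $$\sigma^{(0)}_{(k_1,k_2)}=\sigma^{(2)}_{(k_1,k_2)}=\sqrt{8+\tfrac12(\sigma^+_{k_1})^2+\tfrac12(\sigma^+_{k_2})^2},\qquad \sigma^{(1)}_{(k_1,k_2)}=\sigma^{(3)}_{(k_1,k_2)}=\sqrt{4+\tfrac12(\sigma^-_{k_1})^2+\tfrac12(\sigma^-_{k_2})^2};$$ and the columns of $U^n_{(1)}$ are $u^{(p)}_{(k_1,k_2)}/\sigma^{(p)}_{(k_1,k_2)}$ and have Euclidean norm $1$. -/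

import Mathlib

open scoped BigOperators Matrix

noncomputable section

namespace ADRT

/-- Pixel positions `(i, j) ∈ [N] × [N]` of an `N × N` image, `N = 2 ^ n`. -/
abbrev Pixel (n : ℕ) : Type := Fin (2 ^ n) × Fin (2 ^ n)

/-- The index set `E^n_m = {(h, s) ∈ ℤ × [2 ^ n] | -(s mod 2 ^ m) ≤ h < 2 ^ n}`. The lower end
`-2 ^ m` of the interval only serves to make the set visibly finite, see `mem_dataIndex`. -/
def dataIndex (n m : ℕ) : Finset (ℤ × Fin (2 ^ n)) :=
  (Finset.Ico (-(2 : ℤ) ^ m) (2 ^ n) ×ˢ Finset.univ).filter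
    fun x => -(((x.2 : ℕ) % 2 ^ m : ℕ) : ℤ) ≤ x.1

theorem mem_dataIndex {n m : ℕ} {x : ℤ × Fin (2 ^ n)} :
    x ∈ dataIndex n m ↔ -(((x.2 : ℕ) % 2 ^ m : ℕ) : ℤ) ≤ x.1 ∧ x.1 < 2 ^ n := by
  have h : (((x.2 : ℕ) % 2 ^ m : ℕ) : ℤ) < 2 ^ m := by
    exact_mod_cast Nat.mod_lt (x.2 : ℕ) (by positivity)
  simp only [dataIndex, Finset.mem_filter, Finset.mem_product, Finset.mem_Ico, Finset.mem_univ,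
    and_true]
  constructor
  · rintro ⟨⟨_, h2⟩, h3⟩
    exact ⟨h3, h2⟩
  · rintro ⟨h3, h2⟩
    exact ⟨⟨by linarith, h2⟩, h3⟩

/-- The value `f(h, s)` of an image, extended by zero to all `h ∈ ℤ`, `s ∈ ℕ`. -/
def zeroExt {n : ℕ} (f : Pixel n → ℝ) (h : ℤ) (s : ℕ) : ℝ :=
  if H : (0 ≤ h ∧ h.toNat < 2 ^ n) ∧ s < 2 ^ n then f (⟨h.toNat, H.1.2⟩, ⟨s, H.2⟩) else 0

/-- The first single-quadrant level `S^n_1 : ℝ^(N × N) → ℝ^(E^n_1)`,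
`g(h, 2ℓ) = f(h, 2ℓ) + f(h, 2ℓ + 1)` and `g(h, 2ℓ + 1) = f(h, 2ℓ) + f(h + 1, 2ℓ + 1)`,
where `f` is extended by zero. -/
def singleLevel (n : ℕ) : (Pixel n → ℝ) →ₗ[ℝ] (dataIndex n 1 → ℝ) where
  toFun f x :=
    zeroExt f x.1.1 (2 * ((x.1.2 : ℕ) / 2)) +
      zeroExt f (x.1.1 + ((x.1.2 : ℕ) % 2 : ℕ)) (2 * ((x.1.2 : ℕ) / 2) + 1)
  map_add' f g := by
    funext x
    simp only [zeroExt, Pi.add_apply]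
    split_ifs <;> ring
  map_smul' c f := by
    funext x
    simp only [zeroExt, Pi.smul_apply, smul_eq_mul, RingHom.id_apply]
    split_ifs <;> ring

/-- The pixel of `f` at which the transformed image `T f` of each of the four quadrants
I, II, III, IV (numbered `0, 1, 2, 3`) is read; `Fin.rev i` is `2 ^ n - 1 - i`. -/
def quadrantPixel (n : ℕ) (q : Fin 4) (x : Pixel n) : Pixel n :=
  match q with
  | 0 => (x.2, x.1.rev)
  | 1 => (x.1.rev, x.2)
  | 2 => (x.1, x.2)
  | 3 => (x.2.rev, x.1.rev)

/-- The permutations `T_I, …, T_IV` of images. -/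
def quadrant (n : ℕ) (q : Fin 4) : (Pixel n → ℝ) →ₗ[ℝ] (Pixel n → ℝ) :=
  LinearMap.funLeft ℝ ℝ (quadrantPixel n q)

/-- The cross-quadrant level `S^n_(1) = [S^n_1 T_I, S^n_1 T_II, S^n_1 T_III, S^n_1 T_IV]ᵀ`. -/
def crossLevel (n : ℕ) : (Pixel n → ℝ) →ₗ[ℝ] (Fin 4 × dataIndex n 1 → ℝ) where
  toFun f x := singleLevel n (quadrant n x.1 f) x.2
  map_add' f g := by
    funext x
    simp only [map_add, Pi.add_apply]
  map_smul' c f := by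
    funext x
    simp only [map_smul, Pi.smul_apply, RingHom.id_apply]

/-- The `2 × 2` patterns of the four types `p`. -/
def pattern : Fin 4 → Matrix (Fin 2) (Fin 2) ℝ :=
  ![!![1, 0; 0, 1], !![-1, 0; 0, 1], !![0, 1; 1, 0], !![0, -1; 1, 0]]

/-- Positions `(j₁, j₂) ∈ [N/2] × [N/2]` of the `2 × 2` blocks of an image. -/
abbrev Block (n : ℕ) : Type := Fin (2 ^ n / 2) × Fin (2 ^ n / 2)

/-- `χ^(p)_(j₁, j₂)`: the pattern of type `p` placed in rows `2 j₁, 2 j₁ + 1` and columns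
`2 j₂, 2 j₂ + 1`, and zero elsewhere. -/
def chi (n : ℕ) (p : Fin 4) (j : Block n) (i : Pixel n) : ℝ :=
  if (i.1 : ℕ) / 2 = j.1 ∧ (i.2 : ℕ) / 2 = j.2 then
    pattern p ⟨(i.1 : ℕ) % 2, Nat.mod_lt _ two_pos⟩ ⟨(i.2 : ℕ) % 2, Nat.mod_lt _ two_pos⟩
  else 0

/-- The angle `k π x / (N/2 + 1)`. -/
def angle (n k : ℕ) (x : ℝ) : ℝ := k * Real.pi * x / ((2 : ℝ) ^ n / 2 + 1)

/-- The two-dimensional sine `φ_(k₁, k₂)(j₁, j₂)`, normalized in `ℓ²([N/2] × [N/2])`. -/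
def phi (n k₁ k₂ j₁ j₂ : ℕ) : ℝ :=
  4 / ((2 : ℝ) ^ n + 2) * Real.sin (angle n k₁ (j₁ + 1)) * Real.sin (angle n k₂ (j₂ + 1))

/-- `ψ^(+∘)`, for `j₁ ∈ [N/2 + 1]`, `j₂ ∈ [N/2]`. -/
def psiPlusLeft (n k₁ k₂ j₁ j₂ : ℕ) : ℝ :=
  4 / ((2 : ℝ) ^ n + 2) * Real.sin (angle n k₁ (j₁ + 1 / 2)) * Real.sin (angle n k₂ (j₂ + 1))

/-- `ψ^(∘+)`, for `j₁ ∈ [N/2]`, `j₂ ∈ [N/2 + 1]`. -/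
def psiPlusRight (n k₁ k₂ j₁ j₂ : ℕ) : ℝ :=
  4 / ((2 : ℝ) ^ n + 2) * Real.sin (angle n k₁ (j₁ + 1)) * Real.sin (angle n k₂ (j₂ + 1 / 2))

/-- `ψ^(-∘)`, for `j₁ ∈ [N/2 + 1]`, `j₂ ∈ [N/2]`. -/
def psiMinusLeft (n k₁ k₂ j₁ j₂ : ℕ) : ℝ :=
  4 / ((2 : ℝ) ^ n + 2) * Real.cos (angle n k₁ (j₁ + 1 / 2)) * Real.sin (angle n k₂ (j₂ + 1))

/-- `ψ^(∘-)`, for `j₁ ∈ [N/2]`, `j₂ ∈ [N/2 + 1]`. -/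
def psiMinusRight (n k₁ k₂ j₁ j₂ : ℕ) : ℝ :=
  4 / ((2 : ℝ) ^ n + 2) * Real.sin (angle n k₁ (j₁ + 1)) * Real.cos (angle n k₂ (j₂ + 1 / 2))

/-- `σ⁺_k = 2 cos (k π / (N + 2))`. -/
def sigmaPlus (n k : ℕ) : ℝ := 2 * Real.cos (k * Real.pi / ((2 : ℝ) ^ n + 2))

/-- `σ⁻_k = 2 sin (k π / (N + 2))`. -/
def sigmaMinus (n k : ℕ) : ℝ := 2 * Real.sin (k * Real.pi / ((2 : ℝ) ^ n + 2))

/-- The block-sinusoidal image `v^(p)_(k₁, k₂)`. -/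
def v (n : ℕ) (p : Fin 4) (k₁ k₂ : ℕ) (i : Pixel n) : ℝ :=
  1 / Real.sqrt 2 * ∑ j : Block n, phi n k₁ k₂ j.1 j.2 * chi n p j i

/-- Positions in the four blocks `w₁, w₂, w₃ ∈ ℝ^(N/2 × N/2)` (left summand) and
`w₄ ∈ ℝ^((N/2 + 1) × N/2)` (right summand) into which the data of one quadrant is sorted. -/
abbrev Sorted (n : ℕ) : Type :=
  (Fin 3 × Fin (2 ^ n / 2) × Fin (2 ^ n / 2)) ⊕ (Fin (2 ^ n / 2 + 1) × Fin (2 ^ n / 2))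

/-- The position `(h, s)` in `E^n_1` of an entry of the four blocks:
`w₁` holds `h` odd, `s` even; `w₂` holds `h` even, `s` even; `w₃` holds `h` even, `s` odd;
`w₄` holds `h` odd (including `h = -1`), `s` odd. -/
def sortedPos (n : ℕ) : Sorted n → ℤ × ℕ
  | .inl (0, a, b) => (2 * (a : ℤ) + 1, 2 * (b : ℕ))
  | .inl (1, a, b) => (2 * (a : ℤ), 2 * (b : ℕ))
  | .inl (2, a, b) => (2 * (a : ℤ), 2 * (b : ℕ) + 1)
  | .inr (a, b) => (2 * (a : ℤ) - 1, 2 * (b : ℕ) + 1)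

/-- The permutation matrix `O^n_1`, sorting the data of one quadrant into four blocks. -/
def sortMatrix (n : ℕ) : Matrix (Sorted n) (dataIndex n 1) ℝ :=
  fun b x => if sortedPos n b = (x.1.1, (x.1.2 : ℕ)) then 1 else 0

/-- The coefficients of `φ` in the blocks `w₁, w₂, w₃` of quadrant `q`, for type `p`. -/
def phiCoeff : Fin 4 → Fin 4 → Fin 3 → ℝ :=
  ![![![1, 1, 0], ![1, 1, 0], ![1, 1, 2], ![1, 1, 2]],
    ![![-1, 1, 0], ![-1, 1, 0], ![1, -1, 0], ![-1, 1, 0]],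
    ![![1, 1, 2], ![1, 1, 2], ![1, 1, 0], ![1, 1, 0]],
    ![![1, -1, 0], ![-1, 1, 0], ![1, -1, 0], ![1, -1, 0]]]

/-- The block `φ_(k₁, k₂)` as it appears in quadrant `q` at the block position `(a, b)`, that is,
with the rotation or reflection of the quadrant applied to its argument. -/
def phiBlock (n : ℕ) (q : Fin 4) (k₁ k₂ a b : ℕ) : ℝ :=
  match q with
  | 0 => phi n k₁ k₂ b (2 ^ n / 2 - 1 - a)
  | 1 => phi n k₁ k₂ (2 ^ n / 2 - 1 - a) b
  | 2 => phi n k₁ k₂ a b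
  | 3 => phi n k₁ k₂ (2 ^ n / 2 - 1 - b) (2 ^ n / 2 - 1 - a)

/-- The block `σ⁺ ψ⁺` as it appears in quadrant `q` at the position `(a, b)`, `a ∈ [N/2 + 1]`. -/
def psiPlusBlock (n : ℕ) (q : Fin 4) (k₁ k₂ a b : ℕ) : ℝ :=
  match q with
  | 0 => sigmaPlus n k₂ * psiPlusRight n k₁ k₂ b (2 ^ n / 2 - a)
  | 1 => sigmaPlus n k₁ * psiPlusLeft n k₁ k₂ (2 ^ n / 2 - a) b
  | 2 => sigmaPlus n k₁ * psiPlusLeft n k₁ k₂ a b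
  | 3 => sigmaPlus n k₂ * psiPlusRight n k₁ k₂ (2 ^ n / 2 - 1 - b) (2 ^ n / 2 - a)

/-- The block `σ⁻ ψ⁻` as it appears in quadrant `q` at the position `(a, b)`, `a ∈ [N/2 + 1]`. -/
def psiMinusBlock (n : ℕ) (q : Fin 4) (k₁ k₂ a b : ℕ) : ℝ :=
  match q with
  | 0 => sigmaMinus n k₂ * psiMinusRight n k₁ k₂ b (2 ^ n / 2 - a)
  | 1 => sigmaMinus n k₁ * psiMinusLeft n k₁ k₂ (2 ^ n / 2 - a) b
  | 2 => sigmaMinus n k₁ * psiMinusLeft n k₁ k₂ a b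
  | 3 => sigmaMinus n k₂ * psiMinusRight n k₁ k₂ (2 ^ n / 2 - 1 - b) (2 ^ n / 2 - a)

/-- The block `w₄` of quadrant `q`, for type `p`, without the common factor `1 / √2`. -/
def psiPart (n : ℕ) (p q : Fin 4) (k₁ k₂ a b : ℕ) : ℝ :=
  match p, q with
  | 0, 0 => psiPlusBlock n 0 k₁ k₂ a b
  | 0, 1 => psiPlusBlock n 1 k₁ k₂ a b
  | 1, 0 => -psiMinusBlock n 0 k₁ k₂ a b
  | 1, 1 => -psiMinusBlock n 1 k₁ k₂ a b
  | 2, 2 => psiPlusBlock n 2 k₁ k₂ a b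
  | 2, 3 => psiPlusBlock n 3 k₁ k₂ a b
  | 3, 2 => -psiMinusBlock n 2 k₁ k₂ a b
  | 3, 3 => psiMinusBlock n 3 k₁ k₂ a b
  | _, _ => 0

/-- The part of the column `w^(p)_(k₁, k₂)` that belongs to quadrant `q`. -/
def w (n : ℕ) (p : Fin 4) (k₁ k₂ : ℕ) (q : Fin 4) : Sorted n → ℝ
  | .inl (i, a, b) => 1 / Real.sqrt 2 * (phiCoeff p q i * phiBlock n q k₁ k₂ a b)
  | .inr (a, b) => 1 / Real.sqrt 2 * psiPart n p q k₁ k₂ a b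

/-- `u^(p)_(k₁, k₂) = blockdiag (Oᵀ, Oᵀ, Oᵀ, Oᵀ) w^(p)_(k₁, k₂)`. -/
def u (n : ℕ) (p : Fin 4) (k₁ k₂ : ℕ) (x : Fin 4 × dataIndex n 1) : ℝ :=
  ((sortMatrix n)ᵀ *ᵥ w n p k₁ k₂ x.1) x.2

/-- The diagonal value `σ^(p)_(k₁, k₂)`. -/
def sigma (n : ℕ) (p : Fin 4) (k₁ k₂ : ℕ) : ℝ :=
  match p with
  | 0 => Real.sqrt (8 + 1 / 2 * sigmaPlus n k₁ ^ 2 + 1 / 2 * sigmaPlus n k₂ ^ 2)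
  | 1 => Real.sqrt (4 + 1 / 2 * sigmaMinus n k₁ ^ 2 + 1 / 2 * sigmaMinus n k₂ ^ 2)
  | 2 => Real.sqrt (8 + 1 / 2 * sigmaPlus n k₁ ^ 2 + 1 / 2 * sigmaPlus n k₂ ^ 2)
  | 3 => Real.sqrt (4 + 1 / 2 * sigmaMinus n k₁ ^ 2 + 1 / 2 * sigmaMinus n k₂ ^ 2)

/-- Column indices `(p, k₁, k₂)`. An element `k` of `Fin (N/2)` stands for the frequency `k + 1`,
so that the frequencies run through `1, …, N/2`. -/
abbrev Col (n : ℕ) : Type := Fin 4 × Fin (2 ^ n / 2) × Fin (2 ^ n / 2)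

/-- `V^n_(1)`, with columns `v^(p)_(k₁, k₂)`. -/
def V (n : ℕ) : Matrix (Pixel n) (Col n) ℝ :=
  Matrix.of fun i c => v n c.1 (c.2.1 + 1) (c.2.2 + 1) i

/-- The diagonal of `Σ^n_(1)`. -/
def sigmaDiag (n : ℕ) (c : Col n) : ℝ := sigma n c.1 (c.2.1 + 1) (c.2.2 + 1)

/-- `U^n_(1)`, with columns `u^(p)_(k₁, k₂) / σ^(p)_(k₁, k₂)`. -/
def U (n : ℕ) : Matrix (Fin 4 × dataIndex n 1) (Col n) ℝ :=
  Matrix.of fun x c => u n c.1 (c.2.1 + 1) (c.2.2 + 1) x / sigmaDiag n c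

end ADRT

end

namespace ADRT

/-! ### Sums of trigonometric functions -/

/-! The columns of `V` are tensor products of a two-dimensional discrete sine basis on the `2 × 2`
blocks with four mutually orthogonal patterns. They are orthonormal (`transpose_V_mul_V`), and there
are `4 (N/2)^2 = N^2` of them, so `V` is a square orthogonal matrix. The factorization therefore
reduces to the action on each column, `crossLevel_v`.

That action is explicit once the data are sorted by the parities of `h` and `s`. An entry of `w₁`,
`w₂` or `w₃` adds two pixels of one block, hence is a multiple of `φ`. An entry of `w₄` joins two
vertically adjacent blocks, and sum-to-product turns the neighbouring sines into `σ⁺ ψ⁺` or `σ⁻ ψ⁻`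
at half-integer nodes. The sines vanish at block positions `-1` and `N/2`, so the extension by zero
is built into the formulas and the boundary entries need no separate treatment
(`zeroExt_quadrant_v`).

Finally every `φ` and `ψ` block has norm `1`, so the squared norm of `u` is a sum of squared
coefficients, which equals `σ^2` (`sum_u_sq`). -/

theorem sum_sin_mul_sin_eq_zero {K : ℕ} {α β : ℝ} (hα : Real.sin (K * α) = 0)
    (hβ : Real.sin (K * β) = 0) (h : Real.cos α ≠ Real.cos β) :
    ∑ j ∈ Finset.range K, Real.sin (j * α) * Real.sin (j * β) = 0 := by
  -- Discrete Green identity: both sines solve a second-order difference equation, with eigenvalues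
  -- `2 cos α` and `2 cos β`, so the weighted sum telescopes to a Wronskian. It vanishes at `K` by
  -- the two boundary conditions.
  have telescope : ∀ m : ℕ, 2 * (Real.cos α - Real.cos β) *
      ∑ j ∈ Finset.range m, Real.sin (j * α) * Real.sin (j * β) =
        Real.sin (m * α) * Real.sin (m * β - β) - Real.sin (m * α - α) * Real.sin (m * β) := by
    intro m
    induction m with
    | zero => simp
    | succ m ih =>
      have e1 : ((m + 1 : ℕ) : ℝ) * α = m * α + α := by push_cast; ring
      have e2 : ((m + 1 : ℕ) : ℝ) * β = m * β + β := by push_cast; ring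
      rw [Finset.sum_range_succ, mul_add, ih, e1, e2, add_sub_cancel_right, add_sub_cancel_right,
        Real.sin_add, Real.sin_add, Real.sin_sub, Real.sin_sub]
      ring
  have := telescope K
  rw [hα, hβ, zero_mul, mul_zero, sub_zero] at this
  exact (mul_eq_zero.mp this).resolve_left (mul_ne_zero two_ne_zero (sub_ne_zero.mpr h))

theorem sum_cos_two_mul_add_eq_zero {K k : ℕ} {α : ℝ} (hα : K * α = k * Real.pi)
    (h : Real.sin α ≠ 0) (c : ℝ) :
    ∑ j ∈ Finset.range K, Real.cos (2 * (j * α) + c) = 0 := by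
  have telescope : ∀ m : ℕ, 2 * Real.sin α * ∑ j ∈ Finset.range m, Real.cos (2 * (j * α) + c) =
      Real.sin (2 * (m * α) + c - α) - Real.sin (c - α) := by
    intro m
    induction m with
    | zero => simp
    | succ m ih =>
      have e1 : 2 * (((m + 1 : ℕ) : ℝ) * α) + c - α = (2 * (m * α) + c) + α := by push_cast; ring
      rw [Finset.sum_range_succ, mul_add, ih, e1, Real.sin_add, Real.sin_sub (2 * (m * α) + c)]
      ring
  have := telescope K
  -- The `K` steps of size `2 α` cover `k` full periods, so the two ends of the telescoped sum
  -- agree.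
  have e : 2 * (K * α) + c - α = (c - α) + k * (2 * Real.pi) := by rw [hα]; ring
  rw [e, Real.sin_add_nat_mul_two_pi, sub_self] at this
  exact (mul_eq_zero.mp this).resolve_left (mul_ne_zero two_ne_zero h)

/-- The free phase `c` serves both the integer nodes (`c = 0`) and the half-integer nodes (`c = α /
2`). -/
theorem sum_sin_sq {K k : ℕ} {α : ℝ} (hα : K * α = k * Real.pi) (h : Real.sin α ≠ 0) (c : ℝ) :
    ∑ j ∈ Finset.range K, Real.sin (j * α + c) ^ 2 = K / 2 := by
  have := sum_cos_two_mul_add_eq_zero hα h (2 * c)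
  calc ∑ j ∈ Finset.range K, Real.sin (j * α + c) ^ 2
      = ∑ j ∈ Finset.range K, (1 / 2 - 1 / 2 * Real.cos (2 * (j * α) + 2 * c)) := by
        refine Finset.sum_congr rfl fun j _ => ?_
        rw [← mul_add, Real.cos_two_mul, Real.cos_sq']
        ring
    _ = K / 2 := by
        rw [Finset.sum_sub_distrib, ← Finset.mul_sum, this]
        simp
        ring

theorem sum_cos_sq {K k : ℕ} {α : ℝ} (hα : K * α = k * Real.pi) (h : Real.sin α ≠ 0) (c : ℝ) :
    ∑ j ∈ Finset.range K, Real.cos (j * α + c) ^ 2 = K / 2 := by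
  have := sum_sin_sq hα h c
  simp only [Real.sin_sq, Finset.sum_sub_distrib, Finset.sum_const, Finset.card_range,
    nsmul_eq_mul, mul_one] at this
  linarith

/-! ### The sine and cosine systems on `[N/2]` and `[N/2 + 1]` -/

section Angle

variable {n : ℕ}

theorem half_mul_two (hn : 1 ≤ n) : 2 ^ n / 2 * 2 = 2 ^ n :=
  Nat.div_mul_cancel (dvd_pow_self 2 (by omega))

theorem cast_half (hn : 1 ≤ n) : ((2 ^ n / 2 : ℕ) : ℝ) = (2 : ℝ) ^ n / 2 := by
  rw [Nat.cast_div (dvd_pow_self 2 (by omega)) (by norm_num)]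
  push_cast
  rfl

theorem angle_eq_mul (n k : ℕ) (x : ℝ) : angle n k x = x * angle n k 1 := by
  simp only [angle]; ring

theorem angle_add (n k : ℕ) (x y : ℝ) : angle n k (x + y) = angle n k x + angle n k y := by
  simp only [angle]; ring

theorem angle_zero (n k : ℕ) : angle n k 0 = 0 := by simp [angle]

theorem angle_top (n k : ℕ) : angle n k ((2 : ℝ) ^ n / 2 + 1) = k * Real.pi := by
  have : (2 : ℝ) ^ n / 2 + 1 ≠ 0 := by positivity
  simp only [angle]; field_simp

theorem half_add_one_mul_angle (hn : 1 ≤ n) (k : ℕ) :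
    ((2 ^ n / 2 + 1 : ℕ) : ℝ) * angle n k 1 = k * Real.pi := by
  rw [← angle_top n k, angle_eq_mul n k (_ + 1), Nat.cast_add, cast_half hn, Nat.cast_one]

theorem angle_one_mem_Ioo (hn : 1 ≤ n) (k : Fin (2 ^ n / 2)) :
    angle n (k + 1) 1 ∈ Set.Ioo 0 Real.pi := by
  have h1 : (0 : ℝ) < (2 : ℝ) ^ n / 2 + 1 := by positivity
  have h2 : ((k : ℕ) + 1 : ℝ) < (2 : ℝ) ^ n / 2 + 1 := by
    rw [← cast_half hn]
    exact_mod_cast Nat.add_lt_add_right k.2 1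
  simp only [angle, mul_one, Nat.cast_add, Nat.cast_one]
  refine ⟨by positivity, ?_⟩
  rw [div_lt_iff₀ h1, mul_comm Real.pi]
  exact mul_lt_mul_of_pos_right h2 Real.pi_pos

theorem sin_angle_one_ne_zero (hn : 1 ≤ n) (k : Fin (2 ^ n / 2)) :
    Real.sin (angle n (k + 1) 1) ≠ 0 :=
  (Real.sin_pos_of_mem_Ioo (angle_one_mem_Ioo hn k)).ne'

theorem sum_sin_angle_mul_sin_angle (hn : 1 ≤ n) (k l : Fin (2 ^ n / 2)) :
    ∑ j : Fin (2 ^ n / 2), Real.sin (angle n (k + 1) ((j : ℕ) + 1)) *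
        Real.sin (angle n (l + 1) ((j : ℕ) + 1)) =
      if k = l then ((2 : ℝ) ^ n + 2) / 4 else 0 := by
  -- Prepending the node `0`, where the sine vanishes, gives a sum of length `N/2 + 1`, the length
  -- at which the boundary conditions hold.
  have shift : ∑ j : Fin (2 ^ n / 2), Real.sin (angle n (k + 1) ((j : ℕ) + 1)) *
        Real.sin (angle n (l + 1) ((j : ℕ) + 1)) =
      ∑ j ∈ Finset.range (2 ^ n / 2 + 1), Real.sin (j * angle n (k + 1) 1) *
        Real.sin (j * angle n (l + 1) 1) := by
    rw [Finset.sum_range_succ', Finset.sum_range]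
    simp only [Nat.cast_zero, zero_mul, Real.sin_zero, add_zero, Nat.cast_add, Nat.cast_one]
    refine Finset.sum_congr rfl fun j _ => ?_
    rw [angle_eq_mul, angle_eq_mul n (l + 1)]
  rw [shift]
  split_ifs with h
  · subst h
    have := sum_sin_sq (half_add_one_mul_angle hn (k + 1)) (sin_angle_one_ne_zero hn k) 0
    simp only [add_zero] at this
    simp only [← sq]
    rw [this, Nat.cast_add, cast_half hn]
    push_cast
    ring
  · refine sum_sin_mul_sin_eq_zero ?_ ?_ fun hc => h ?_
    · rw [half_add_one_mul_angle hn, Real.sin_nat_mul_pi]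
    · rw [half_add_one_mul_angle hn, Real.sin_nat_mul_pi]
    -- All angles lie in `(0, π)`, where the cosine is injective, so equal cosines force equal
    -- frequencies.
    · have := Real.injOn_cos (Set.Ioo_subset_Icc_self (angle_one_mem_Ioo hn k))
        (Set.Ioo_subset_Icc_self (angle_one_mem_Ioo hn l)) hc
      simp only [angle, mul_one] at this
      have h1 : (2 : ℝ) ^ n / 2 + 1 ≠ 0 := by positivity
      have h2 := mul_right_cancel₀ Real.pi_ne_zero ((div_left_inj' h1).mp this)
      exact Fin.ext (Nat.succ_injective (by exact_mod_cast h2))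

theorem sum_sin_angle_sq (hn : 1 ≤ n) (k : Fin (2 ^ n / 2)) :
    ∑ j : Fin (2 ^ n / 2), Real.sin (angle n (k + 1) ((j : ℕ) + 1)) ^ 2 =
      ((2 : ℝ) ^ n + 2) / 4 := by
  simpa [sq] using sum_sin_angle_mul_sin_angle hn k k

theorem sum_sin_angle_half_sq (hn : 1 ≤ n) (k : Fin (2 ^ n / 2)) :
    ∑ j : Fin (2 ^ n / 2 + 1), Real.sin (angle n (k + 1) ((j : ℕ) + 1 / 2)) ^ 2 =
      ((2 : ℝ) ^ n + 2) / 4 := by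
  have := sum_sin_sq (half_add_one_mul_angle hn (k + 1)) (sin_angle_one_ne_zero hn k)
    (angle n (k + 1) (1 / 2))
  simp only [Finset.sum_range, ← angle_eq_mul, ← angle_add, Nat.cast_add, cast_half hn] at this
  rw [this]
  push_cast
  ring

theorem sum_cos_angle_half_sq (hn : 1 ≤ n) (k : Fin (2 ^ n / 2)) :
    ∑ j : Fin (2 ^ n / 2 + 1), Real.cos (angle n (k + 1) ((j : ℕ) + 1 / 2)) ^ 2 =
      ((2 : ℝ) ^ n + 2) / 4 := by
  have := sum_cos_sq (half_add_one_mul_angle hn (k + 1)) (sin_angle_one_ne_zero hn k)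
    (angle n (k + 1) (1 / 2))
  simp only [Finset.sum_range, ← angle_eq_mul, ← angle_add, Nat.cast_add, cast_half hn] at this
  rw [this]
  push_cast
  ring

theorem angle_half (n k : ℕ) : angle n k (1 / 2) = k * Real.pi / ((2 : ℝ) ^ n + 2) := by
  have h1 : (2 : ℝ) ^ n / 2 + 1 ≠ 0 := by positivity
  have h2 : (2 : ℝ) ^ n + 2 ≠ 0 := by positivity
  simp only [angle]
  field_simp

/-- Sum-to-product about the midpoint `x + 1/2`: the half step has angle `k π / (N + 2)`, which is
where `σ⁺` and the shift by `1/2` come from. -/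
theorem sigmaPlus_mul_sin (n k : ℕ) (x : ℝ) :
    sigmaPlus n k * Real.sin (angle n k (x + 1 / 2)) =
      Real.sin (angle n k (x + 1)) + Real.sin (angle n k x) := by
  rw [sigmaPlus, ← angle_half, show x + 1 = x + 1 / 2 + 1 / 2 by ring, angle_add n k (x + 1 / 2),
    show angle n k x = angle n k (x + 1 / 2) - angle n k (1 / 2) by rw [angle_add]; ring,
    Real.sin_add, Real.sin_sub]
  ring

theorem sigmaMinus_mul_cos (n k : ℕ) (x : ℝ) :
    sigmaMinus n k * Real.cos (angle n k (x + 1 / 2)) =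
      Real.sin (angle n k (x + 1)) - Real.sin (angle n k x) := by
  rw [sigmaMinus, ← angle_half, show x + 1 = x + 1 / 2 + 1 / 2 by ring, angle_add n k (x + 1 / 2),
    show angle n k x = angle n k (x + 1 / 2) - angle n k (1 / 2) by rw [angle_add]; ring,
    Real.sin_add, Real.sin_sub]
  ring

end Angle

/-! ### Block coordinates of pixels and orthonormality of `V` -/

section Pixels

variable {n : ℕ}

/-- `(a, r) ↦ 2 a + r`. -/
def blockCoord (hn : 1 ≤ n) : Fin (2 ^ n / 2) × Fin 2 ≃ Fin (2 ^ n) :=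
  finProdFinEquiv.trans (finCongr (half_mul_two hn))

theorem blockCoord_val (hn : 1 ≤ n) (a : Fin (2 ^ n / 2)) (r : Fin 2) :
    (blockCoord hn (a, r) : ℕ) = r + 2 * a := rfl

/-- Since `2 m - 1 - (2 a + r) = 2 (m - 1 - a) + (1 - r)`, a reflection of the image acts separately
on the blocks and inside each block. -/
theorem rev_blockCoord (hn : 1 ≤ n) (a : Fin (2 ^ n / 2)) (r : Fin 2) :
    (blockCoord hn (a, r)).rev = blockCoord hn (a.rev, r.rev) := by
  have := half_mul_two hn
  apply Fin.ext
  simp only [Fin.val_rev, blockCoord_val]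
  omega

theorem v_blockCoord (hn : 1 ≤ n) (p : Fin 4) (k₁ k₂ : ℕ) (a b : Fin (2 ^ n / 2)) (r s : Fin 2) :
    v n p k₁ k₂ (blockCoord hn (a, r), blockCoord hn (b, s)) =
      1 / Real.sqrt 2 * (phi n k₁ k₂ a b * pattern p r s) := by
  have hd (a : Fin (2 ^ n / 2)) (r : Fin 2) : (blockCoord hn (a, r) : ℕ) / 2 = a := by
    rw [blockCoord_val]; omega
  have hm (a : Fin (2 ^ n / 2)) (r : Fin 2) :
      (⟨(blockCoord hn (a, r) : ℕ) % 2, Nat.mod_lt _ two_pos⟩ : Fin 2) = r := by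
    apply Fin.ext
    simp only [blockCoord_val]; omega
  simp only [v, chi, hd, hm]
  rw [Finset.sum_eq_single (a, b)]
  · simp
  · intro j _ hj
    rw [if_neg, mul_zero]
    rintro ⟨h1, h2⟩
    exact hj (Prod.ext (Fin.ext h1.symm) (Fin.ext h2.symm))
  · simp

/-- The squared norm `2` of each pattern is what the factor `1 / √2` in `v` compensates. -/
theorem sum_pattern_mul_pattern (p p' : Fin 4) :
    pattern p 0 0 * pattern p' 0 0 + pattern p 0 1 * pattern p' 0 1 +
      pattern p 1 0 * pattern p' 1 0 + pattern p 1 1 * pattern p' 1 1 =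
        if p = p' then 2 else 0 := by
  fin_cases p <;> fin_cases p' <;> simp [pattern] <;> norm_num

theorem sum_phi_mul_phi (hn : 1 ≤ n) (k₁ k₂ l₁ l₂ : Fin (2 ^ n / 2)) :
    ∑ a : Fin (2 ^ n / 2), ∑ b : Fin (2 ^ n / 2),
      phi n (k₁ + 1) (k₂ + 1) a b * phi n (l₁ + 1) (l₂ + 1) a b =
        if k₁ = l₁ ∧ k₂ = l₂ then 1 else 0 := by
  have h : (2 : ℝ) ^ n + 2 ≠ 0 := by positivity
  calc _ = (4 / ((2 : ℝ) ^ n + 2)) ^ 2 *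
        ((∑ a : Fin (2 ^ n / 2), Real.sin (angle n (k₁ + 1) ((a : ℕ) + 1)) *
          Real.sin (angle n (l₁ + 1) ((a : ℕ) + 1))) *
        ∑ b : Fin (2 ^ n / 2), Real.sin (angle n (k₂ + 1) ((b : ℕ) + 1)) *
          Real.sin (angle n (l₂ + 1) ((b : ℕ) + 1))) := by
        rw [Finset.sum_mul_sum, Finset.mul_sum]
        refine Finset.sum_congr rfl fun a _ => ?_
        rw [Finset.mul_sum]
        refine Finset.sum_congr rfl fun b _ => ?_
        simp only [phi]
        ring
    _ = _ := by
        rw [sum_sin_angle_mul_sin_angle hn, sum_sin_angle_mul_sin_angle hn]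
        by_cases h1 : k₁ = l₁ <;> by_cases h2 : k₂ = l₂ <;> simp [h1, h2]
        field_simp

theorem transpose_V_mul_V (hn : 1 ≤ n) : (V n)ᵀ * V n = 1 := by
  ext ⟨p, k₁, k₂⟩ ⟨p', l₁, l₂⟩
  have hs : (1 / Real.sqrt 2) ^ 2 = 1 / 2 := by
    rw [div_pow, Real.sq_sqrt zero_le_two, one_pow]
  rw [Matrix.mul_apply, ← Equiv.sum_comp (Equiv.prodCongr (blockCoord hn) (blockCoord hn)),
    Fintype.sum_prod_type, Fintype.sum_prod_type]
  simp only [Fintype.sum_prod_type, Fin.sum_univ_two, Matrix.transpose_apply, V, Matrix.of_apply,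
    Equiv.prodCongr_apply, Prod.map, v_blockCoord]
  calc _ = (1 / Real.sqrt 2) ^ 2 *
        (∑ a : Fin (2 ^ n / 2), ∑ b : Fin (2 ^ n / 2),
          phi n (k₁ + 1) (k₂ + 1) a b * phi n (l₁ + 1) (l₂ + 1) a b) *
        (pattern p 0 0 * pattern p' 0 0 + pattern p 0 1 * pattern p' 0 1 +
          pattern p 1 0 * pattern p' 1 0 + pattern p 1 1 * pattern p' 1 1) := by
        rw [Finset.mul_sum, Finset.sum_mul]
        refine Finset.sum_congr rfl fun a _ => ?_
        rw [Finset.mul_sum, Finset.sum_mul, ← Finset.sum_add_distrib]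
        refine Finset.sum_congr rfl fun b _ => ?_
        ring
    _ = _ := by
        rw [hs, sum_phi_mul_phi hn, sum_pattern_mul_pattern, Matrix.one_apply]
        simp only [Prod.mk.injEq]
        by_cases h1 : p = p' <;> by_cases h2 : k₁ = l₁ <;> by_cases h3 : k₂ = l₂ <;>
          simp [h1, h2, h3]

/-- A left inverse of a square matrix is a right inverse; only the count `4 (N/2)^2 = N^2` has to be
checked. -/
theorem V_mul_transpose_V (hn : 1 ≤ n) : V n * (V n)ᵀ = 1 := by
  refine (Matrix.mul_eq_one_comm_of_card_eq (Col n) (Pixel n) ℝ ?_).mp (transpose_V_mul_V hn)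
  have := half_mul_two hn
  simp only [Fintype.card_prod, Fintype.card_fin]
  generalize 2 ^ n / 2 = m at this ⊢
  rw [← this]
  ring

end Pixels

/-! ### Sorting the data of one quadrant -/

section Sorting

variable {n : ℕ}

theorem sortedPos_injective (n : ℕ) : Function.Injective (sortedPos n) := by
  rintro (⟨i, a, b⟩ | ⟨a, b⟩) (⟨i', a', b'⟩ | ⟨a', b'⟩) h
  · fin_cases i <;> fin_cases i' <;>
      simp [sortedPos, Fin.ext_iff] at h ⊢ <;> omega
  · fin_cases i <;> simp only [sortedPos, Prod.mk.injEq] at h <;> omega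
  · fin_cases i' <;> simp only [sortedPos, Prod.mk.injEq] at h <;> omega
  · simp only [sortedPos, Prod.mk.injEq, Sum.inr.injEq, Fin.ext_iff] at h ⊢
    omega

theorem sortedPos_snd_lt (hn : 1 ≤ n) (t : Sorted n) : (sortedPos n t).2 < 2 ^ n := by
  have := half_mul_two hn
  rcases t with ⟨i, a, b⟩ | ⟨a, b⟩
  · fin_cases i <;> simp only [sortedPos] <;> omega
  · simp only [sortedPos]
    omega

theorem sortedPos_mem (hn : 1 ≤ n) (t : Sorted n) :
    ((sortedPos n t).1, (⟨(sortedPos n t).2, sortedPos_snd_lt hn t⟩ : Fin (2 ^ n))) ∈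
      dataIndex n 1 := by
  have h : ((2 ^ n / 2 : ℕ) : ℤ) * 2 = 2 ^ n := by exact_mod_cast half_mul_two hn
  rw [mem_dataIndex]
  rcases t with ⟨i, a, b⟩ | ⟨a, b⟩
  · have := a.2
    rw [← h]
    fin_cases i <;> simp only [sortedPos] <;> omega
  · have := a.2
    rw [← h]
    simp only [sortedPos]
    omega

/-- The position in `E^n_1` of an entry of the four blocks. -/
def sortedIndex (hn : 1 ≤ n) (t : Sorted n) : dataIndex n 1 :=
  ⟨_, sortedPos_mem hn t⟩

theorem sortedIndex_bijective (hn : 1 ≤ n) : Function.Bijective (sortedIndex hn) := by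
  constructor
  · intro t t' h
    simp only [sortedIndex, Subtype.mk.injEq, Prod.mk.injEq, Fin.mk.injEq] at h
    exact sortedPos_injective n (Prod.ext h.1 h.2)
  · rintro ⟨⟨h, s, hs⟩, hx⟩
    have hz : ((2 ^ n / 2 : ℕ) : ℤ) * 2 = 2 ^ n := by exact_mod_cast half_mul_two hn
    have hN := half_mul_two hn
    rw [mem_dataIndex] at hx
    simp only [pow_one] at hx
    -- With `2 ^ n` written as twice the atom `2 ^ n / 2`, the range conditions become linear.
    rw [← hz] at hx
    suffices ∃ t, sortedPos n t = (h, s) by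
      obtain ⟨t, ht⟩ := this
      refine ⟨t, Subtype.ext (Prod.ext ?_ (Fin.ext ?_))⟩
      · exact (congrArg Prod.fst ht : (sortedPos n t).1 = h)
      · exact (congrArg Prod.snd ht : (sortedPos n t).2 = s)
    have hb : s / 2 < 2 ^ n / 2 := by omega
    rcases Nat.mod_two_eq_zero_or_one s with h2 | h2 <;>
      rcases Int.emod_two_eq_zero_or_one h with h3 | h3
    · refine ⟨.inl (1, ⟨(h / 2).toNat, by omega⟩, ⟨s / 2, hb⟩), ?_⟩
      simp only [sortedPos, Prod.mk.injEq]
      omega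
    · refine ⟨.inl (0, ⟨(h / 2).toNat, by omega⟩, ⟨s / 2, hb⟩), ?_⟩
      simp only [sortedPos, Prod.mk.injEq]
      omega
    · refine ⟨.inl (2, ⟨(h / 2).toNat, by omega⟩, ⟨s / 2, hb⟩), ?_⟩
      simp only [sortedPos, Prod.mk.injEq]
      omega
    -- The shift by one makes room for `h = -1`, which becomes row `0` of `w₄`.
    · refine ⟨.inr (⟨((h + 1) / 2).toNat, by omega⟩, ⟨s / 2, hb⟩), ?_⟩
      simp only [sortedPos, Prod.mk.injEq]
      omega

theorem u_sortedIndex (hn : 1 ≤ n) (p : Fin 4) (k₁ k₂ : ℕ) (q : Fin 4) (t : Sorted n) :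
    u n p k₁ k₂ (q, sortedIndex hn t) = w n p k₁ k₂ q t := by
  simp only [u, Matrix.mulVec, dotProduct, Matrix.transpose_apply, sortMatrix, sortedIndex,
    Prod.mk.eta, (sortedPos_injective n).eq_iff, ite_mul, one_mul, zero_mul]
  rw [Finset.sum_ite_eq' Finset.univ t, if_pos (Finset.mem_univ t)]

end Sorting

/-! ### The cross-quadrant level on the block-sinusoidal images -/

section Level

variable {n : ℕ}

theorem zeroExt_fin (f : Pixel n → ℝ) (i j : Fin (2 ^ n)) :
    zeroExt f ((i : ℕ) : ℤ) j = f (i, j) := by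
  rw [zeroExt, dif_pos ⟨⟨by positivity, by simp⟩, j.2⟩]
  rfl

theorem zeroExt_of_neg (f : Pixel n → ℝ) {h : ℤ} (hh : h < 0) (s : ℕ) : zeroExt f h s = 0 :=
  dif_neg fun H => by omega

theorem zeroExt_of_le (f : Pixel n → ℝ) {h : ℤ} (hh : ((2 ^ n : ℕ) : ℤ) ≤ h) (s : ℕ) :
    zeroExt f h s = 0 :=
  dif_neg fun H => by omega

/-- `phi` at real arguments. -/
noncomputable def phiReal (n k₁ k₂ : ℕ) (x y : ℝ) : ℝ :=
  4 / ((2 : ℝ) ^ n + 2) * Real.sin (angle n k₁ (x + 1)) * Real.sin (angle n k₂ (y + 1))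

/-- `phiBlock` at real arguments. -/
noncomputable def phiBlockReal (n : ℕ) (q : Fin 4) (k₁ k₂ : ℕ) (x y : ℝ) : ℝ :=
  match q with
  | 0 => phiReal n k₁ k₂ y ((2 : ℝ) ^ n / 2 - 1 - x)
  | 1 => phiReal n k₁ k₂ ((2 : ℝ) ^ n / 2 - 1 - x) y
  | 2 => phiReal n k₁ k₂ x y
  | 3 => phiReal n k₁ k₂ ((2 : ℝ) ^ n / 2 - 1 - y) ((2 : ℝ) ^ n / 2 - 1 - x)

theorem phi_eq_phiReal (n k₁ k₂ a b : ℕ) : phi n k₁ k₂ a b = phiReal n k₁ k₂ a b := rfl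

theorem cast_half_sub_one_sub (hn : 1 ≤ n) (a : Fin (2 ^ n / 2)) :
    ((2 ^ n / 2 - 1 - a : ℕ) : ℝ) = (2 : ℝ) ^ n / 2 - 1 - (a : ℕ) := by
  have := a.2
  rw [Nat.cast_sub (by omega), Nat.cast_sub (by omega), cast_half hn, Nat.cast_one]

theorem cast_half_sub (hn : 1 ≤ n) (a : Fin (2 ^ n / 2 + 1)) :
    ((2 ^ n / 2 - a : ℕ) : ℝ) = (2 : ℝ) ^ n / 2 - (a : ℕ) := by
  rw [Nat.cast_sub (by omega), cast_half hn]

theorem phiBlock_eq_phiBlockReal (hn : 1 ≤ n) (q : Fin 4) (k₁ k₂ : ℕ) (a b : Fin (2 ^ n / 2)) :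
    phiBlock n q k₁ k₂ a b = phiBlockReal n q k₁ k₂ (a : ℕ) (b : ℕ) := by
  fin_cases q <;>
    simp only [phiBlock, phiBlockReal, phi_eq_phiReal, cast_half_sub_one_sub hn]

/-- In every orientation the position `-1` puts one sine factor at angle `0` or `k π`. Real
arguments are essential here, as truncated subtraction would lose the positions just outside the
block grid. -/
theorem phiBlockReal_neg_one (n : ℕ) (q : Fin 4) (k₁ k₂ : ℕ) (y : ℝ) :
    phiBlockReal n q k₁ k₂ (-1) y = 0 := by
  fin_cases q <;>
    simp [phiBlockReal, phiReal, angle_top, angle_zero, Real.sin_nat_mul_pi]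

theorem phiBlockReal_top (n : ℕ) (q : Fin 4) (k₁ k₂ : ℕ) (y : ℝ) :
    phiBlockReal n q k₁ k₂ ((2 : ℝ) ^ n / 2) y = 0 := by
  fin_cases q <;>
    simp [phiBlockReal, phiReal, angle_top, angle_zero, Real.sin_nat_mul_pi]

/-- The pattern of type `p` as it appears in quadrant `q`. -/
def quadrantPattern (p q : Fin 4) (r s : Fin 2) : ℝ :=
  match q with
  | 0 => pattern p s r.rev
  | 1 => pattern p r.rev s
  | 2 => pattern p r s
  | 3 => pattern p s.rev r.rev

theorem quadrant_v_blockCoord (hn : 1 ≤ n) (p q : Fin 4) (k₁ k₂ : ℕ) (a b : Fin (2 ^ n / 2))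
    (r s : Fin 2) :
    quadrant n q (v n p k₁ k₂) (blockCoord hn (a, r), blockCoord hn (b, s)) =
      1 / Real.sqrt 2 *
        (phiBlockReal n q k₁ k₂ (a : ℕ) (b : ℕ) * quadrantPattern p q r s) := by
  have hrev (a : Fin (2 ^ n / 2)) : (a.rev : ℕ) = 2 ^ n / 2 - 1 - a := by
    rw [Fin.val_rev]; omega
  rw [← phiBlock_eq_phiBlockReal hn]
  simp only [quadrant, LinearMap.funLeft_apply]
  fin_cases q <;>
    simp only [quadrantPixel, rev_blockCoord, v_blockCoord, phiBlock, quadrantPattern, hrev]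

/-- One formula covers the interior and the rows of blocks `-1` and `N/2`: there the left side is
zero by extension and the right side by the zeros of the sine. -/
theorem zeroExt_quadrant_v (hn : 1 ≤ n) (p q : Fin 4) (k₁ k₂ : ℕ) (a : ℤ) (ha : -1 ≤ a)
    (ha' : a ≤ (2 ^ n / 2 : ℕ)) (b : Fin (2 ^ n / 2)) (r s : Fin 2) :
    zeroExt (quadrant n q (v n p k₁ k₂)) (2 * a + (r : ℕ)) (2 * b + s) =
      1 / Real.sqrt 2 * (phiBlockReal n q k₁ k₂ a (b : ℕ) * quadrantPattern p q r s) := by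
  have hN := half_mul_two hn
  rcases ha.eq_or_lt with rfl | ha
  · rw [zeroExt_of_neg _ (by omega)]
    push_cast
    rw [phiBlockReal_neg_one, zero_mul, mul_zero]
  rcases ha'.eq_or_lt with rfl | ha'
  · rw [zeroExt_of_le _ (by omega), Int.cast_natCast, cast_half hn, phiBlockReal_top, zero_mul,
      mul_zero]
  lift a to ℕ using by omega
  have h := zeroExt_fin (quadrant n q (v n p k₁ k₂)) (blockCoord hn (⟨a, by omega⟩, r))
    (blockCoord hn (b, s))
  rw [quadrant_v_blockCoord, blockCoord_val, blockCoord_val, add_comm (s : ℕ),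
    add_comm (r : ℕ)] at h
  exact_mod_cast h

theorem sigmaPlus_mul_psiPlusLeft (n k₁ k₂ : ℕ) (x y : ℝ) :
    sigmaPlus n k₁ * (4 / ((2 : ℝ) ^ n + 2) * Real.sin (angle n k₁ (x + 1 / 2)) *
        Real.sin (angle n k₂ (y + 1))) =
      phiReal n k₁ k₂ x y + phiReal n k₁ k₂ (x - 1) y := by
  simp only [phiReal, sub_add_cancel]
  linear_combination 4 / ((2 : ℝ) ^ n + 2) * Real.sin (angle n k₂ (y + 1)) *
    sigmaPlus_mul_sin n k₁ x

theorem sigmaPlus_mul_psiPlusRight (n k₁ k₂ : ℕ) (x y : ℝ) :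
    sigmaPlus n k₂ * (4 / ((2 : ℝ) ^ n + 2) * Real.sin (angle n k₁ (x + 1)) *
        Real.sin (angle n k₂ (y + 1 / 2))) =
      phiReal n k₁ k₂ x y + phiReal n k₁ k₂ x (y - 1) := by
  simp only [phiReal, sub_add_cancel]
  linear_combination 4 / ((2 : ℝ) ^ n + 2) * Real.sin (angle n k₁ (x + 1)) *
    sigmaPlus_mul_sin n k₂ y

theorem sigmaMinus_mul_psiMinusLeft (n k₁ k₂ : ℕ) (x y : ℝ) :
    sigmaMinus n k₁ * (4 / ((2 : ℝ) ^ n + 2) * Real.cos (angle n k₁ (x + 1 / 2)) *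
        Real.sin (angle n k₂ (y + 1))) =
      phiReal n k₁ k₂ x y - phiReal n k₁ k₂ (x - 1) y := by
  simp only [phiReal, sub_add_cancel]
  linear_combination 4 / ((2 : ℝ) ^ n + 2) * Real.sin (angle n k₂ (y + 1)) *
    sigmaMinus_mul_cos n k₁ x

theorem sigmaMinus_mul_psiMinusRight (n k₁ k₂ : ℕ) (x y : ℝ) :
    sigmaMinus n k₂ * (4 / ((2 : ℝ) ^ n + 2) * Real.sin (angle n k₁ (x + 1)) *
        Real.cos (angle n k₂ (y + 1 / 2))) =
      phiReal n k₁ k₂ x y - phiReal n k₁ k₂ x (y - 1) := by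
  simp only [phiReal, sub_add_cancel]
  linear_combination 4 / ((2 : ℝ) ^ n + 2) * Real.sin (angle n k₁ (x + 1)) *
    sigmaMinus_mul_cos n k₂ y

/-- The two neighbouring values of `phiBlockReal` combine to the block `w₄` of each quadrant. -/
theorem psiPart_eq (hn : 1 ≤ n) (p q : Fin 4) (k₁ k₂ : ℕ) (a : Fin (2 ^ n / 2 + 1))
    (b : Fin (2 ^ n / 2)) :
    psiPart n p q k₁ k₂ a b =
      phiBlockReal n q k₁ k₂ ((a : ℕ) - 1) (b : ℕ) * quadrantPattern p q 1 0 +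
        phiBlockReal n q k₁ k₂ (a : ℕ) (b : ℕ) * quadrantPattern p q 0 1 := by
  -- In the orientations that reverse rows, the blocks `a - 1` and `a` land at `N/2 - a` and `N/2 -
  -- a - 1`, the adjacent pair expected by the sum-to-product lemmas.
  have e1 : (2 : ℝ) ^ n / 2 - 1 - ((a : ℕ) - 1) = (2 : ℝ) ^ n / 2 - (a : ℕ) := by ring
  have e2 : (2 : ℝ) ^ n / 2 - 1 - (a : ℕ) = (2 : ℝ) ^ n / 2 - (a : ℕ) - 1 := by ring
  fin_cases p <;> fin_cases q <;>
    simp only [psiPart, psiPlusBlock, psiMinusBlock, psiPlusLeft, psiPlusRight, psiMinusLeft,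
      psiMinusRight, sigmaPlus_mul_psiPlusLeft, sigmaPlus_mul_psiPlusRight,
      sigmaMinus_mul_psiMinusLeft, sigmaMinus_mul_psiMinusRight, phiBlockReal, e1, e2,
      cast_half_sub hn, cast_half_sub_one_sub hn] <;>
    simp [quadrantPattern, pattern] <;> ring

theorem phiCoeff_eq (p q : Fin 4) :
    phiCoeff p q 0 = quadrantPattern p q 1 0 + quadrantPattern p q 1 1 ∧
      phiCoeff p q 1 = quadrantPattern p q 0 0 + quadrantPattern p q 0 1 ∧
      phiCoeff p q 2 = quadrantPattern p q 0 0 + quadrantPattern p q 1 1 := by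
  fin_cases p <;> fin_cases q <;> simp [phiCoeff, quadrantPattern, pattern] <;> norm_num

theorem singleLevel_quadrant_v (hn : 1 ≤ n) (p q : Fin 4) (k₁ k₂ : ℕ) (t : Sorted n) :
    singleLevel n (quadrant n q (v n p k₁ k₂)) (sortedIndex hn t) = w n p k₁ k₂ q t := by
  have main := zeroExt_quadrant_v hn p q k₁ k₂
  -- Both sides of the index are definitionally given by `sortedPos`, so each block reduces to
  -- arithmetic on its position.
  change zeroExt (quadrant n q (v n p k₁ k₂)) (sortedPos n t).1 (2 * ((sortedPos n t).2 / 2)) +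
    zeroExt (quadrant n q (v n p k₁ k₂)) ((sortedPos n t).1 + ((sortedPos n t).2 % 2 : ℕ))
      (2 * ((sortedPos n t).2 / 2) + 1) = w n p k₁ k₂ q t
  obtain ⟨c0, c1, c2⟩ := phiCoeff_eq p q
  rcases t with ⟨i, a, b⟩ | ⟨a, b⟩
  · have h (r s : Fin 2) := main a (by omega) (by omega) b r s
    have h00 := h 0 0
    have h01 := h 0 1
    have h10 := h 1 0
    have h11 := h 1 1
    have d0 : 2 * (b : ℕ) / 2 = b := by omega
    have d1 : (2 * (b : ℕ) + 1) / 2 = b := by omega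
    have m0 : 2 * (b : ℕ) % 2 = 0 := by omega
    have m1 : (2 * (b : ℕ) + 1) % 2 = 1 := by omega
    simp only [Fin.val_zero, Fin.val_one, Nat.cast_zero, Nat.cast_one, add_zero,
      Int.cast_natCast] at h00 h01 h10 h11
    simp only [w, phiBlock_eq_phiBlockReal hn]
    fin_cases i <;>
      simp only [sortedPos, Fin.zero_eta, Fin.mk_one, Fin.reduceFinMk, d0, d1, m0, m1,
        Nat.cast_zero, Nat.cast_one, add_zero, h00, h01, h10, h11, c0, c1, c2] <;> ring
  -- Row `2 a - 1` is the odd row of block `a - 1`, and the next row is the even row of block `a`.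
  -- The extremes `a = 0` and `a = N/2` reach outside the image.
  · have h10 := main (a - 1) (by omega) (by omega) b 1 0
    have h01 := main a (by omega) (by omega) b 0 1
    have d1 : (2 * (b : ℕ) + 1) / 2 = b := by omega
    have m1 : (2 * (b : ℕ) + 1) % 2 = 1 := by omega
    have e1 : 2 * ((a : ℕ) - 1 : ℤ) + 1 = 2 * (a : ℕ) - 1 := by ring
    simp only [Fin.val_zero, Fin.val_one, Nat.cast_zero, Nat.cast_one, add_zero, Int.cast_sub,
      Int.cast_one, Int.cast_natCast, e1] at h10 h01
    simp only [sortedPos, w, psiPart_eq hn, d1, m1, Nat.cast_one, sub_add_cancel, h10, h01]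
    ring

theorem crossLevel_v (hn : 1 ≤ n) (p : Fin 4) (k₁ k₂ : ℕ) :
    crossLevel n (v n p k₁ k₂) = u n p k₁ k₂ := by
  funext ⟨q, x⟩
  obtain ⟨t, rfl⟩ := (sortedIndex_bijective hn).surjective x
  rw [u_sortedIndex]
  exact singleLevel_quadrant_v hn p q k₁ k₂ t

end Level

/-! ### Norms of the columns of `U` -/

section Norm

variable {n : ℕ}

theorem sum_half_sub_one_sub (F : ℕ → ℝ) :
    ∑ a : Fin (2 ^ n / 2), F (2 ^ n / 2 - 1 - a) = ∑ a : Fin (2 ^ n / 2), F a := by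
  rw [← Equiv.sum_comp Fin.revPerm (fun a : Fin (2 ^ n / 2) => F a)]
  refine Finset.sum_congr rfl fun a _ => congrArg F ?_
  rw [Fin.revPerm_apply, Fin.val_rev]
  omega

theorem sum_half_sub (F : ℕ → ℝ) :
    ∑ a : Fin (2 ^ n / 2 + 1), F (2 ^ n / 2 - a) = ∑ a : Fin (2 ^ n / 2 + 1), F a := by
  rw [← Equiv.sum_comp Fin.revPerm (fun a : Fin (2 ^ n / 2 + 1) => F a)]
  refine Finset.sum_congr rfl fun a _ => congrArg F ?_
  rw [Fin.revPerm_apply, Fin.val_rev]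
  omega

theorem sum_phiBlock_sq (hn : 1 ≤ n) (q : Fin 4) (k₁ k₂ : Fin (2 ^ n / 2)) :
    ∑ a : Fin (2 ^ n / 2), ∑ b : Fin (2 ^ n / 2),
      phiBlock n q (k₁ + 1) (k₂ + 1) a b ^ 2 = 1 := by
  have h : ∑ a : Fin (2 ^ n / 2), ∑ b : Fin (2 ^ n / 2),
      phi n (k₁ + 1) (k₂ + 1) a b ^ 2 = 1 := by
    simpa [sq] using sum_phi_mul_phi hn k₁ k₂ k₁ k₂
  rw [← h]
  fin_cases q <;> simp only [phiBlock]
  · rw [sum_half_sub_one_sub (fun a => ∑ b : Fin (2 ^ n / 2),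
      phi n (k₁ + 1) (k₂ + 1) b a ^ 2), Finset.sum_comm]
  · rw [sum_half_sub_one_sub (fun a => ∑ b : Fin (2 ^ n / 2),
      phi n (k₁ + 1) (k₂ + 1) a b ^ 2)]
  · rw [sum_half_sub_one_sub (fun a => ∑ b : Fin (2 ^ n / 2),
      phi n (k₁ + 1) (k₂ + 1) (2 ^ n / 2 - 1 - b) a ^ 2), Finset.sum_comm,
      sum_half_sub_one_sub (fun b => ∑ a : Fin (2 ^ n / 2),
      phi n (k₁ + 1) (k₂ + 1) b a ^ 2)]

/-- Each one-dimensional factor has squared norm `(N + 2) / 4`, on the integer and on the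
half-integer nodes alike, so the prefactor `4 / (N + 2)` normalizes every product. -/
theorem sum_sq_of_product {A B : Type*} [Fintype A] [Fintype B] (s : ℝ) (F : A → ℝ) (G : B → ℝ)
    (hF : ∑ a, F a ^ 2 = ((2 : ℝ) ^ n + 2) / 4) (hG : ∑ b, G b ^ 2 = ((2 : ℝ) ^ n + 2) / 4) :
    ∑ a, ∑ b, (s * (4 / ((2 : ℝ) ^ n + 2) * F a * G b)) ^ 2 = s ^ 2 := by
  have h : (2 : ℝ) ^ n + 2 ≠ 0 := by positivity
  calc _ = s ^ 2 * (4 / ((2 : ℝ) ^ n + 2)) ^ 2 * ((∑ a, F a ^ 2) * ∑ b, G b ^ 2) := by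
        rw [Finset.sum_mul_sum, Finset.mul_sum]
        refine Finset.sum_congr rfl fun a _ => ?_
        rw [Finset.mul_sum]
        exact Finset.sum_congr rfl fun b _ => by ring
    _ = s ^ 2 := by
        rw [hF, hG]
        field_simp

theorem sum_psiPlusLeft_sq (hn : 1 ≤ n) (k₁ k₂ : Fin (2 ^ n / 2)) (s : ℝ) :
    ∑ a : Fin (2 ^ n / 2 + 1), ∑ b : Fin (2 ^ n / 2),
      (s * psiPlusLeft n (k₁ + 1) (k₂ + 1) a b) ^ 2 = s ^ 2 :=
  sum_sq_of_product s _ _ (sum_sin_angle_half_sq hn k₁) (sum_sin_angle_sq hn k₂)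

theorem sum_psiMinusLeft_sq (hn : 1 ≤ n) (k₁ k₂ : Fin (2 ^ n / 2)) (s : ℝ) :
    ∑ a : Fin (2 ^ n / 2 + 1), ∑ b : Fin (2 ^ n / 2),
      (s * psiMinusLeft n (k₁ + 1) (k₂ + 1) a b) ^ 2 = s ^ 2 :=
  sum_sq_of_product s _ _ (sum_cos_angle_half_sq hn k₁) (sum_sin_angle_sq hn k₂)

theorem sum_psiPlusRight_sq (hn : 1 ≤ n) (k₁ k₂ : Fin (2 ^ n / 2)) (s : ℝ) :
    ∑ a : Fin (2 ^ n / 2), ∑ b : Fin (2 ^ n / 2 + 1),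
      (s * psiPlusRight n (k₁ + 1) (k₂ + 1) a b) ^ 2 = s ^ 2 :=
  sum_sq_of_product s _ _ (sum_sin_angle_sq hn k₁) (sum_sin_angle_half_sq hn k₂)

theorem sum_psiMinusRight_sq (hn : 1 ≤ n) (k₁ k₂ : Fin (2 ^ n / 2)) (s : ℝ) :
    ∑ a : Fin (2 ^ n / 2), ∑ b : Fin (2 ^ n / 2 + 1),
      (s * psiMinusRight n (k₁ + 1) (k₂ + 1) a b) ^ 2 = s ^ 2 :=
  sum_sq_of_product s _ _ (sum_sin_angle_sq hn k₁) (sum_cos_angle_half_sq hn k₂)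

/-- Sums over a block in each of the four orientations in which `psiPart` uses it. -/
theorem sum_block_orientation (F : ℕ → ℕ → ℝ) :
    (∑ a : Fin (2 ^ n / 2 + 1), ∑ b : Fin (2 ^ n / 2), F b (2 ^ n / 2 - a) =
        ∑ b : Fin (2 ^ n / 2), ∑ a : Fin (2 ^ n / 2 + 1), F b a) ∧
      (∑ a : Fin (2 ^ n / 2 + 1), ∑ b : Fin (2 ^ n / 2), F (2 ^ n / 2 - a) b =
        ∑ a : Fin (2 ^ n / 2 + 1), ∑ b : Fin (2 ^ n / 2), F a b) ∧
      ∑ a : Fin (2 ^ n / 2 + 1), ∑ b : Fin (2 ^ n / 2), F (2 ^ n / 2 - 1 - b) (2 ^ n / 2 - a) =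
        ∑ b : Fin (2 ^ n / 2), ∑ a : Fin (2 ^ n / 2 + 1), F b a := by
  refine ⟨?_, sum_half_sub fun a => ∑ b : Fin (2 ^ n / 2), F a b, ?_⟩
  · rw [sum_half_sub fun a => ∑ b : Fin (2 ^ n / 2), F b a, Finset.sum_comm]
  · rw [sum_half_sub fun a => ∑ b : Fin (2 ^ n / 2), F (2 ^ n / 2 - 1 - b) a, Finset.sum_comm,
      sum_half_sub_one_sub fun b => ∑ a : Fin (2 ^ n / 2 + 1), F b a]

theorem sum_psiPlusBlock_sq (hn : 1 ≤ n) (q : Fin 4) (k₁ k₂ : Fin (2 ^ n / 2)) :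
    ∑ a : Fin (2 ^ n / 2 + 1), ∑ b : Fin (2 ^ n / 2),
      psiPlusBlock n q (k₁ + 1) (k₂ + 1) a b ^ 2 =
        ![sigmaPlus n (k₂ + 1) ^ 2, sigmaPlus n (k₁ + 1) ^ 2, sigmaPlus n (k₁ + 1) ^ 2,
          sigmaPlus n (k₂ + 1) ^ 2] q := by
  fin_cases q
  · exact ((sum_block_orientation fun a b => (sigmaPlus n (k₂ + 1) *
      psiPlusRight n (k₁ + 1) (k₂ + 1) a b) ^ 2).1).trans (sum_psiPlusRight_sq hn k₁ k₂ _)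
  · exact ((sum_block_orientation fun a b => (sigmaPlus n (k₁ + 1) *
      psiPlusLeft n (k₁ + 1) (k₂ + 1) a b) ^ 2).2.1).trans (sum_psiPlusLeft_sq hn k₁ k₂ _)
  · exact sum_psiPlusLeft_sq hn k₁ k₂ _
  · exact ((sum_block_orientation fun a b => (sigmaPlus n (k₂ + 1) *
      psiPlusRight n (k₁ + 1) (k₂ + 1) a b) ^ 2).2.2).trans (sum_psiPlusRight_sq hn k₁ k₂ _)

theorem sum_psiMinusBlock_sq (hn : 1 ≤ n) (q : Fin 4) (k₁ k₂ : Fin (2 ^ n / 2)) :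
    ∑ a : Fin (2 ^ n / 2 + 1), ∑ b : Fin (2 ^ n / 2),
      psiMinusBlock n q (k₁ + 1) (k₂ + 1) a b ^ 2 =
        ![sigmaMinus n (k₂ + 1) ^ 2, sigmaMinus n (k₁ + 1) ^ 2, sigmaMinus n (k₁ + 1) ^ 2,
          sigmaMinus n (k₂ + 1) ^ 2] q := by
  fin_cases q
  · exact ((sum_block_orientation fun a b => (sigmaMinus n (k₂ + 1) *
      psiMinusRight n (k₁ + 1) (k₂ + 1) a b) ^ 2).1).trans (sum_psiMinusRight_sq hn k₁ k₂ _)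
  · exact ((sum_block_orientation fun a b => (sigmaMinus n (k₁ + 1) *
      psiMinusLeft n (k₁ + 1) (k₂ + 1) a b) ^ 2).2.1).trans (sum_psiMinusLeft_sq hn k₁ k₂ _)
  · exact sum_psiMinusLeft_sq hn k₁ k₂ _
  · exact ((sum_block_orientation fun a b => (sigmaMinus n (k₂ + 1) *
      psiMinusRight n (k₁ + 1) (k₂ + 1) a b) ^ 2).2.2).trans (sum_psiMinusRight_sq hn k₁ k₂ _)

theorem sum_w_sq (hn : 1 ≤ n) (p q : Fin 4) (k₁ k₂ : Fin (2 ^ n / 2)) :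
    ∑ t, w n p (k₁ + 1) (k₂ + 1) q t ^ 2 =
      1 / 2 * (phiCoeff p q 0 ^ 2 + phiCoeff p q 1 ^ 2 + phiCoeff p q 2 ^ 2 +
        ∑ a : Fin (2 ^ n / 2 + 1), ∑ b : Fin (2 ^ n / 2),
          psiPart n p q (k₁ + 1) (k₂ + 1) a b ^ 2) := by
  have hs : (1 / Real.sqrt 2) ^ 2 = 1 / 2 := by
    rw [div_pow, Real.sq_sqrt zero_le_two, one_pow]
  simp only [Fintype.sum_sum_type, Fintype.sum_prod_type, Fin.sum_univ_three, w, mul_pow, hs,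
    ← Finset.mul_sum, sum_phiBlock_sq hn]
  ring

/-- Sorting is a bijection, so norms can be computed on the blocks. For `p = 0, 2`, two quadrants
contribute `1 + (σ⁺)^2 / 2` each and two contribute `3` each. For `p = 1, 3`, two contribute `1 +
(σ⁻)^2 / 2` each and two contribute `1` each. In each case one of the two `ψ` quadrants carries `k₁`
and the other `k₂`. -/
theorem sum_u_sq (hn : 1 ≤ n) (p : Fin 4) (k₁ k₂ : Fin (2 ^ n / 2)) :
    ∑ x, u n p (k₁ + 1) (k₂ + 1) x ^ 2 = sigma n p (k₁ + 1) (k₂ + 1) ^ 2 := by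
  have hsum (q : Fin 4) : ∑ x, u n p (k₁ + 1) (k₂ + 1) (q, x) ^ 2 =
      ∑ t, w n p (k₁ + 1) (k₂ + 1) q t ^ 2 := by
    rw [← (sortedIndex_bijective hn).sum_comp]
    simp only [u_sortedIndex]
  rw [Fintype.sum_prod_type]
  simp only [hsum, sum_w_sq hn]
  have plus (q) := sum_psiPlusBlock_sq hn q k₁ k₂
  have minus (q) := sum_psiMinusBlock_sq hn q k₁ k₂
  fin_cases p <;> simp only [sigma] <;> rw [Real.sq_sqrt (by positivity)] <;>
    simp [Fin.sum_univ_four, psiPart, plus, minus, phiCoeff] <;> ring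

theorem sigmaDiag_pos (n : ℕ) (c : Col n) : 0 < sigmaDiag n c := by
  obtain ⟨p, k₁, k₂⟩ := c
  fin_cases p <;> simp only [sigmaDiag, sigma] <;> positivity

theorem crossLevel_mul_V (hn : 1 ≤ n) :
    LinearMap.toMatrix' (crossLevel n) * V n = U n * Matrix.diagonal (sigmaDiag n) := by
  ext x c
  rw [Matrix.mul_diagonal, U, Matrix.of_apply, div_mul_cancel₀ _ (sigmaDiag_pos n c).ne',
    ← crossLevel_v hn]
  exact congrFun (LinearMap.toMatrix'_mulVec (crossLevel n) (fun i => V n i c)) x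

end Norm

end ADRT

theorem theorem4p1 (n : ℕ) (hn : 1 ≤ n) :
    LinearMap.toMatrix' (ADRT.crossLevel n)
        = ADRT.U n * Matrix.diagonal (ADRT.sigmaDiag n) * (ADRT.V n)ᵀ ∧
      (ADRT.V n)ᵀ * ADRT.V n = 1 ∧
      ∀ c : ADRT.Col n, ∑ x, ADRT.U n x c ^ 2 = 1 := by
  refine ⟨?_, ADRT.transpose_V_mul_V hn, fun c => ?_⟩
  -- Orthogonality of the rows of `V` cancels `V Vᵀ` after multiplying the columnwise identity by
  -- `Vᵀ`.
  · rw [← ADRT.crossLevel_mul_V hn, Matrix.mul_assoc, ADRT.V_mul_transpose_V hn, Matrix.mul_one]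
  · have h := pow_ne_zero 2 (ADRT.sigmaDiag_pos n c).ne'
    simp only [ADRT.U, Matrix.of_apply, div_pow, ← Finset.sum_div]
    rw [ADRT.sum_u_sq hn]
    exact div_self h
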